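/- A \emph{causal-net} is a finite directed multigraph $G$ (vertex set $V(G)$, edge set $E(G)$, source and target maps $s,t$) without closed directed paths of positive length; it may be empty and may have isolated vertices and parallel edges. Its \emph{path category} $\mathbf{P}(G)$ has the vertices as objects and the directed paths as morphisms, with paths of length zero as identities and juxtaposition as composition. The category $\mathbf{Cau}$ has the causal-nets as objects, and a morphism $\lambda:G\to H$ is a functor $\mathbf{P}(G)\to\mathbf{P}(H)$; thus $\lambda$ sends each vertex to a vertex and each edge $e$ to a directed path from $\lambda(s(e))$ to $\lambda(t(e))$. A morphism $\lambda:G\to H$ is \emph{fundamental} if it is of one of the following six types (each understood up to isomorphism of $G$ and of $H$). 1. \emph{Subdividing an edge.} For some edge $e_0$ of $G$, $H$ is obtained from $G$ by replacing $e_0$ by two consecutive edges $a,b$ through one new vertex $w$; $\lambda(e_0)$ is the path $a$ followed by $b$, and $\lambda$ is the identity on vertices and on the other edges. 2. \emph{Adding an edge.} $H$ is obtained from $G$ by adding one edge, and $\lambda$ is the inclusion. 3. \emph{Adding an isolated vertex.} $H$ is obtained from $G$ by adding one isolated vertex, and $\lambda$ is the inclusion. 4. \emph{Merging two vertices.} $H$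 is obtained from $G$ by identifying two distinct (necessarily incomparable) vertices and keeping all edges, and $\lambda$ is the quotient morphism, bijective from $E(G)$ to $E(H)$. 5. \emph{Coarse-graining two parallel edges.} $H$ is obtained from $G$ by identifying two distinct edges with the same source and the same target, and $\lambda$ is the quotient morphism, bijective on vertices. 6. \emph{Contracting an edge.} For some edge $e_0$ of $G$ (necessarily the only directed path from $s(e_0)$ to $t(e_0)$), $H$ is obtained from $G$ by deleting $e_0$ and identifying its two ends; $\lambda(e_0)$ is an identity, and $\lambda$ is the quotient map on vertices and a bijection from $E(G)\setminus\{e_0\}$ onto $E(H)$. \textbf{Theorem} (fundamental theorem of $\mathbf{Cau}$). Every morphism $\lambda:G\to H$ of causal-nets is a composite of finitely many fundamental morphisms, identities counting as empty composites. (If $H$ is empty, then $G$ is empty too and $\lambda$ is the unique isomorphism between them, that is, the identity of the empty causal-net.) -/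

import Mathlib

open CategoryTheory

universe u

/-- A directed multigraph: a set `V` of vertices, a set `E` of edges, and the source and target of
each edge. -/
structure DirMultigraph where
  V : Type u
  E : Type u
  src : E → V
  tgt : E → V

namespace DirMultigraph

/-- The arrows from `x` to `y` are the edges with source `x` and target `y`, so `Quiver.Path x y`
is the type of directed paths from `x` to `y` and `Paths G.V` is the path category. -/
instance instQuiver (G : DirMultigraph.{u}) : Quiver.{u} G.V where
  Hom x y := {e : G.E // G.src e = x ∧ G.tgt e = y}

/-- An edge as an arrow from its source to its target. -/
def arrow (G : DirMultigraph.{u}) (e : G.E) : G.src e ⟶ G.tgt e := ⟨e, rfl, rfl⟩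

/-- The edges traversed by a directed path, from the first to the last. A directed path is
determined by its two ends together with this list. -/
def edges (G : DirMultigraph.{u}) {x : G.V} : {y : G.V} → Quiver.Path x y → List G.E
  | _, .nil => []
  | _, .cons p e => G.edges p ++ [e.1]

/-- There is no closed directed path of positive length (in particular no loop). -/
def Acyclic (G : DirMultigraph.{u}) : Prop :=
  ∀ (x : G.V) (p : Quiver.Path x x), p.length = 0

end DirMultigraph

/-- A causal-net: a finite acyclic directed multigraph, possibly empty, possibly with isolated
vertices and with parallel edges. -/
structure CausalNet extends DirMultigraph.{u} where
  finite_V : Finite V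
  finite_E : Finite E
  acyclic : toDirMultigraph.Acyclic

namespace CausalNet

/-- The causal-net category: a morphism of causal-nets is a functor between path categories. -/
instance instCategory : Category.{u} CausalNet.{u} where
  Hom G H := Paths G.V ⥤ Paths H.V
  id G := 𝟭 (Paths G.V)
  comp F F' := Functor.comp F F'

variable {G H : CausalNet.{u}}

/-- A morphism, seen as a functor between path categories. -/
def toFunctor (F : G ⟶ H) : Paths G.V ⥤ Paths H.V := F

/-- The action of a morphism on vertices. -/
def onV (F : G ⟶ H) (x : G.V) : H.V := (toFunctor F).obj x

/-- The action of a morphism on edges: an edge `e` is sent to a directed path from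
`onV F (src e)` to `onV F (tgt e)`, which is recorded as its list of edges. Thus `onE F e = []` says
that `e` is sent to an identity, `onE F e = [f]` that it is sent to the edge `f`, and
`onE F e = [f, f']` that it is sent to the path formed by `f` followed by `f'`. -/
def onE (F : G ⟶ H) (e : G.E) : List H.E :=
  H.edges ((toFunctor F).map ((Paths.of G.V).map (G.arrow e)))

/-! Each of the six types is described intrinsically, by saying that `H` is, up to renaming its
vertices and edges, the result of the operation, and that `F` is the associated morphism. All six
conditions are therefore invariant under isomorphisms of `G` and of `H`. Since `H` is required to be
a causal-net, an operation that would create a directed cycle is never allowed. -/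

/-- Subdividing an edge: an edge `e₀` is replaced by a path consisting of two new edges `a`, `b`
through a new vertex `w`; the morphism sends `e₀` to that path. -/
def SubdividesEdge (F : G ⟶ H) : Prop :=
  ∃ (e₀ : G.E) (w : H.V) (a b : H.E) (φ : {e : G.E // e ≠ e₀} → H.E),
    Function.Injective (onV F) ∧ Set.range (onV F) = {w}ᶜ ∧
    H.tgt a = w ∧ H.src b = w ∧ onE F e₀ = [a, b] ∧
    Function.Injective φ ∧ Set.range φ = {a, b}ᶜ ∧ ∀ e, onE F e.1 = [φ e]

/-- Adding an edge: `H` has the vertices and edges of `G` and exactly one more edge `f`. -/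
def AddsEdge (F : G ⟶ H) : Prop :=
  ∃ (f : H.E) (φ : G.E → H.E),
    Function.Bijective (onV F) ∧
    Function.Injective φ ∧ Set.range φ = {f}ᶜ ∧ ∀ e, onE F e = [φ e]

/-- Adding an isolated vertex: `H` has the vertices and edges of `G` and exactly one more vertex
`w`, which is isolated. -/
def AddsIsolatedVertex (F : G ⟶ H) : Prop :=
  ∃ (w : H.V) (φ : G.E → H.E),
    (∀ f, H.src f ≠ w ∧ H.tgt f ≠ w) ∧
    Function.Injective (onV F) ∧ Set.range (onV F) = {w}ᶜ ∧
    Function.Bijective φ ∧ ∀ e, onE F e = [φ e]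

/-- `F` is surjective on vertices, and identifies the two vertices `x` and `y` and no others. -/
def GluesExactly (F : G ⟶ H) (x y : G.V) : Prop :=
  Function.Surjective (onV F) ∧
  ∀ p q, onV F p = onV F q ↔ p = q ∨ (p = x ∧ q = y) ∨ (p = y ∧ q = x)

/-- Merging two vertices: two distinct vertices are identified, and every edge is kept. (The two
vertices are then necessarily incomparable, as a directed path joining them would be sent to a
closed directed path of positive length.) -/
def MergesTwoVertices (F : G ⟶ H) : Prop :=
  ∃ (x y : G.V) (φ : G.E → H.E),
    x ≠ y ∧ GluesExactly F x y ∧ Function.Bijective φ ∧ ∀ e, onE F e = [φ e]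

/-- Coarse-graining two parallel edges: two distinct edges with the same source and the same target
are identified; nothing else changes. -/
def CoarseGrainsParallelEdges (F : G ⟶ H) : Prop :=
  ∃ (e₁ e₂ : G.E) (φ : G.E → H.E),
    e₁ ≠ e₂ ∧ G.src e₁ = G.src e₂ ∧ G.tgt e₁ = G.tgt e₂ ∧
    Function.Bijective (onV F) ∧ Function.Surjective φ ∧
    (∀ p q, φ p = φ q ↔ p = q ∨ (p = e₁ ∧ q = e₂) ∨ (p = e₂ ∧ q = e₁)) ∧
    ∀ e, onE F e = [φ e]

/-- Contracting an edge: an edge `e₀` is sent to an identity, its two ends are identified, and every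
other edge is kept. (The edge `e₀` is then necessarily the only directed path from its source to its
target.) -/
def ContractsEdge (F : G ⟶ H) : Prop :=
  ∃ (e₀ : G.E) (φ : {e : G.E // e ≠ e₀} → H.E),
    GluesExactly F (G.src e₀) (G.tgt e₀) ∧ onE F e₀ = [] ∧
    Function.Bijective φ ∧ ∀ e, onE F e.1 = [φ e]

/-- The class of the morphisms of the six fundamental types. -/
def fundamental : MorphismProperty CausalNet.{u} := fun _ _ F =>
  SubdividesEdge F ∨ AddsEdge F ∨ AddsIsolatedVertex F ∨
  MergesTwoVertices F ∨ CoarseGrainsParallelEdges F ∨ ContractsEdge F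

end CausalNet

/-! Fundamental morphisms are peeled off the source side: `F = A ≫ B` with `A` fundamental and `B`
simpler, a natural number decreasing each time (`multiplicativeClosure_of_step`). Subdivisions bring
every edge image to length at most one. Contractions and coarse-grainings then remove the edges sent
to identities, mergings and coarse-grainings make the morphism injective, and added vertices and
edges make it bijective. A bijective morphism adds a vertex and merges it back.

The point at issue is that every intermediate net is acyclic, which is certified by a height
increasing along edges. Once no edge is sent to an identity, a height on `H` pulls back along `F`
(`onV_lt_of_ne_nil`). Contraction is the delicate case: a badly chosen edge could close a cycle, so
one of minimal height difference is taken (`exists_height_of_minimal`). -/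

namespace DirMultigraph

/-! ### Directed walks as lists of edges; height functions. -/

variable {G : DirMultigraph.{u}}

/-- `G.IsWalk x l y` says that the list of edges `l` forms a directed walk from `x` to `y`. -/
def IsWalk (G : DirMultigraph.{u}) : G.V → List G.E → G.V → Prop
  | x, [], y => x = y
  | x, e :: l, y => G.src e = x ∧ G.IsWalk (G.tgt e) l y

theorem isWalk_append {x z : G.V} {l l' : List G.E} :
    G.IsWalk x (l ++ l') z ↔ ∃ y, G.IsWalk x l y ∧ G.IsWalk y l' z := by
  induction l generalizing x with
  | nil => simp [IsWalk]
  | cons e l ih => simp [IsWalk, ih, and_assoc]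

theorem isWalk_singleton {x y : G.V} {e : G.E} :
    G.IsWalk x [e] y ↔ G.src e = x ∧ G.tgt e = y := Iff.rfl

theorem isWalk_edges {x y : G.V} (p : Quiver.Path x y) : G.IsWalk x (G.edges p) y := by
  induction p with
  | nil => rfl
  | cons p e ih => exact isWalk_append.2 ⟨_, ih, e.2⟩

theorem edges_comp {x y z : G.V} (p : Quiver.Path x y) (q : Quiver.Path y z) :
    G.edges (p.comp q) = G.edges p ++ G.edges q := by
  induction q with
  | nil => simp [edges]
  | cons q e ih => simp [edges, ih]

theorem edges_injective {x y : G.V} {p q : Quiver.Path x y} (h : G.edges p = G.edges q) :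
    p = q := by
  induction p with
  | nil =>
    cases q with
    | nil => rfl
    | cons q e => simp [edges] at h
  | cons p e ih =>
    cases q with
    | nil => simp [edges] at h
    | cons q f =>
      obtain ⟨e, he, he'⟩ := e
      obtain ⟨f, hf, hf'⟩ := f
      obtain ⟨h₁, h₂⟩ := List.append_inj' h rfl
      obtain rfl : e = f := by simpa using h₂
      obtain rfl := he.symm.trans hf
      rw [ih h₁]

theorem IsWalk.exists_path {x y : G.V} {l : List G.E} (h : G.IsWalk x l y) :
    ∃ p : Quiver.Path x y, G.edges p = l := by
  induction l generalizing x with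
  | nil => obtain rfl : x = y := h; exact ⟨.nil, rfl⟩
  | cons e l ih =>
    obtain ⟨rfl, h⟩ := h
    obtain ⟨p, rfl⟩ := ih h
    exact ⟨(G.arrow e).toPath.comp p, by rw [edges_comp]; rfl⟩

theorem acyclic_of_lt {α : Type*} [Preorder α] (f : G.V → α)
    (hf : ∀ e, f (G.src e) < f (G.tgt e)) : G.Acyclic := by
  have key : ∀ {x y : G.V} (p : Quiver.Path x y), p.length = 0 ∨ f x < f y := by
    intro x y p
    induction p with
    | nil => exact .inl rfl
    | @cons y z p e ih =>
      obtain ⟨e, rfl, rfl⟩ := e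
      right
      rcases ih with h | h
      · rw [Quiver.Path.eq_of_length_zero p h]
        exact hf e
      · exact h.trans (hf e)
  exact fun x p => (key p).resolve_right (lt_irrefl _)

theorem Acyclic.exists_injective_lt [Finite G.V] (hG : G.Acyclic) :
    ∃ f : G.V → ℕ, Function.Injective f ∧ ∀ e, f (G.src e) < f (G.tgt e) := by
  let past (x : G.V) : Set G.V := {z | Nonempty (Quiver.Path z x)}
  have hpast : ∀ e, past (G.src e) ⊂ past (G.tgt e) := by
    intro e
    refine Set.ssubset_iff_of_subset ?_ |>.2 ⟨G.tgt e, ⟨.nil⟩, ?_⟩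
    · rintro z ⟨p⟩
      exact ⟨p.cons (G.arrow e)⟩
    · rintro ⟨p⟩
      exact absurd (hG _ (p.cons (G.arrow e))) (Nat.succ_ne_zero _)
  obtain ⟨n, ⟨i⟩⟩ := Finite.exists_equiv_fin G.V
  -- The past grows strictly along edges. Scaling its size by `n` leaves room for the enumeration `i
  -- x < n` to break ties, and `i x` is recovered modulo `n`.
  refine ⟨fun x => i x + n * (past x).ncard, fun x y h => ?_, fun e => ?_⟩
  · have h' := congrArg (· % n) h
    simp only [Nat.add_mul_mod_self_left, Nat.mod_eq_of_lt (i _).2] at h'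
    exact i.injective (Fin.ext h')
  · have h := Set.ncard_lt_ncard (hpast e) (Set.toFinite _)
    have h' := Nat.mul_le_mul_left n h
    have h₁ := (i (G.src e)).2
    rw [Nat.mul_succ] at h'
    dsimp only
    omega

end DirMultigraph

namespace CausalNet

open DirMultigraph

variable {G H K : CausalNet.{u}}

instance (G : CausalNet.{u}) : Finite G.V := G.finite_V

instance (G : CausalNet.{u}) : Finite G.E := G.finite_E

/-! ### Morphisms described by their values on vertices and edges. -/

theorem isWalk_onE (F : G ⟶ H) (e : G.E) :
    H.IsWalk (onV F (G.src e)) (onE F e) (onV F (G.tgt e)) :=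
  isWalk_edges _

theorem edges_map (F : G ⟶ H) {x y : G.V} (p : Quiver.Path x y) :
    H.edges ((toFunctor F).map (X := x) (Y := y) p) = (G.edges p).flatMap (onE F) := by
  induction p with
  | nil =>
    have := (toFunctor F).map_id (x : Paths G.V)
    exact congrArg H.edges this
  | @cons y z p e ih =>
    obtain ⟨e, rfl, rfl⟩ := e
    have := (toFunctor F).map_comp (X := x) p ((Paths.of G.V).map (G.arrow e))
    refine (congrArg H.edges this).trans ((edges_comp _ _).trans ?_)
    simp only [edges, List.flatMap_append, List.flatMap_singleton, ← ih]
    rfl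

-- Path categories are free and a path is determined by its ends and edge list, so equality of
-- functors reduces to equalities free of dependent types.
@[ext]
theorem hom_ext {F F' : G ⟶ H} (hV : ∀ x, onV F x = onV F' x) (hE : ∀ e, onE F e = onE F' e) :
    F = F' := by
  have h : ∀ {x y : G.V} (p : Quiver.Path x y), H.edges ((toFunctor F).map (X := x) (Y := y) p) =
      H.edges ((toFunctor F').map (X := x) (Y := y) p) := fun p => by
    rw [edges_map, edges_map, funext hE]
  obtain ⟨obj, map, _, _⟩ := F
  obtain ⟨obj', map', _, _⟩ := F'
  obtain rfl : obj = obj' := funext hV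
  obtain rfl : @map = @map' := by
    funext x y p
    exact edges_injective (h p)
  rfl

@[simp]
theorem onE_comp (F : G ⟶ H) (F' : H ⟶ K) (e : G.E) :
    onE (F ≫ F') e = (onE F e).flatMap (onE F') := edges_map F' _

/-- The morphism with prescribed action on vertices and edges. -/
noncomputable def homMk (fV : G.V → H.V) (fE : G.E → List H.E)
    (h : ∀ e, H.IsWalk (fV (G.src e)) (fE e) (fV (G.tgt e))) : G ⟶ H :=
  Paths.lift (C := Paths H.V)
    { obj := fV
      map := fun {x y} f => (IsWalk.exists_path (G := H.toDirMultigraph) (x := fV x) (y := fV y)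
        (l := fE f.1) (by obtain ⟨e, rfl, rfl⟩ := f; exact h e)).choose }

@[simp]
theorem onE_homMk (fV : G.V → H.V) (fE : G.E → List H.E)
    (h : ∀ e, H.IsWalk (fV (G.src e)) (fE e) (fV (G.tgt e))) (e : G.E) :
    onE (homMk fV fE h) e = fE e := by
  have h' := Exists.choose_spec (IsWalk.exists_path (h e))
  refine Eq.trans ?_ h'
  unfold onE homMk toFunctor
  erw [Paths.lift_toPath]
  rfl

theorem onV_lt_of_ne_nil {α : Type*} [Preorder α] (f : H.V → α)
    (hf : ∀ e, f (H.src e) < f (H.tgt e)) (F : G ⟶ H) (e : G.E) (he : onE F e ≠ []) :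
    f (onV F (G.src e)) < f (onV F (G.tgt e)) := by
  have key : ∀ (l : List H.E) (x y : H.V), H.IsWalk x l y → f x ≤ f y ∧ (l ≠ [] → f x < f y) := by
    intro l
    induction l with
    | nil => rintro x y rfl; exact ⟨le_rfl, fun h => absurd rfl h⟩
    | cons e l ih =>
      rintro x y ⟨rfl, h⟩
      have := (hf e).trans_le (ih _ _ h).1
      exact ⟨this.le, fun _ => this⟩
  exact (key _ _ _ (isWalk_onE F e)).2 he

theorem onE_comp_of_eq_nil {F : G ⟶ H} {F' : H ⟶ K} {e : G.E}
    (h : onE F e = []) : onE (F ≫ F') e = [] := by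
  rw [onE_comp, h, List.flatMap_nil]

theorem onE_comp_of_eq_singleton {F : G ⟶ H} {F' : H ⟶ K} {e : G.E} {f : H.E}
    (h : onE F e = [f]) : onE (F ≫ F') e = onE F' f := by
  rw [onE_comp, h, List.flatMap_singleton]

theorem onE_comp_of_eq_pair {F : G ⟶ H} {F' : H ⟶ K} {e : G.E} {f f' : H.E}
    (h : onE F e = [f, f']) : onE (F ≫ F') e = onE F' f ++ onE F' f' := by
  simp [h]

theorem range_some_eq_compl {α : Type*} : Set.range (some : α → Option α) = {none}ᶜ := by
  ext (_ | v) <;> simp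

/-! ### Subdividing an edge -/

open Classical in
/-- Subdivision of the edge `e₀`: the edge `some e₀` now ends at the new vertex `none`, where the
new edge `none` starts. -/
noncomputable def subdivision (G : CausalNet.{u}) (e₀ : G.E) : CausalNet.{u} where
  V := Option G.V
  E := Option G.E
  src := Option.map G.src
  tgt e := e.elim (some (G.tgt e₀)) fun e => if e = e₀ then none else some (G.tgt e)
  finite_V := inferInstance
  finite_E := inferInstance
  acyclic := by
    obtain ⟨f, -, hf⟩ := G.acyclic.exists_injective_lt
    -- Doubling `f` frees an odd value for the new vertex, just above the source of `e₀` and below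
    -- its target.
    refine acyclic_of_lt (α := ℕ) (fun v : Option G.V => v.elim (2 * f (G.src e₀) + 1)
      fun v => 2 * f v) ?_
    rintro (_ | e)
    · have := hf e₀
      simp only [Option.map_none, Option.elim_none, Option.elim_some]
      omega
    · have := hf e
      by_cases h : e = e₀
      · simp [h]
      · simpa [h] using this

/-- Only the first edge `a` of the image is split off; the new edge `none` carries the rest, one
edge shorter than before. -/
theorem exists_subdivision (F : G ⟶ H) (e₀ : G.E) (a b : H.E) (l : List H.E)
    (he₀ : onE F e₀ = a :: b :: l) :
    ∃ (A : G ⟶ G.subdivision e₀) (B : G.subdivision e₀ ⟶ H), fundamental A ∧ A ≫ B = F ∧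
      onE B (none : Option G.E) = b :: l ∧ onE B (some e₀ : Option G.E) = [a] ∧
      ∀ e : G.E, e ≠ e₀ → onE B (some e : Option G.E) = onE F e := by
  classical
  obtain ⟨hw₁, hw₂⟩ : H.src a = onV F (G.src e₀) ∧
      H.IsWalk (H.tgt a) (b :: l) (onV F (G.tgt e₀)) := by
    have := isWalk_onE F e₀
    rwa [he₀] at this
  let A : G ⟶ G.subdivision e₀ :=
    homMk (H := G.subdivision e₀) (fun v => (some v : Option G.V))
      (fun e => if e = e₀ then ([some e, none] : List (Option G.E)) else [some e]) (by
        intro e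
        by_cases h : e = e₀
        · subst h
          simp [IsWalk, subdivision]
        · simp [IsWalk, subdivision, h])
  let B : G.subdivision e₀ ⟶ H :=
    homMk (G := G.subdivision e₀) (fun v : Option G.V => v.elim (H.tgt a) (onV F))
      (fun e : Option G.E => e.elim (b :: l) fun e => if e = e₀ then [a] else onE F e) (by
        rintro (_ | e)
        · exact hw₂
        · by_cases h : e = e₀
          · subst h
            simp [IsWalk, subdivision, hw₁]
          · simpa [subdivision, h] using isWalk_onE F e)
  have hB : ∀ e : Option G.E, onE B e =
      e.elim (b :: l) fun e => if e = e₀ then [a] else onE F e := onE_homMk (G := G.subdivision e₀) _ _ _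
  have hA : ∀ e, onE A e = if e = e₀ then ([some e, none] : List (Option G.E)) else [some e] :=
    onE_homMk _ _ _
  refine ⟨A, B, .inl ⟨e₀, (none : Option G.V), (some e₀ : Option G.E), (none : Option G.E),
    fun e => (some e.1 : Option G.E), Option.some_injective _, ?_, ?_, rfl, ?_, ?_, ?_, ?_⟩,
    hom_ext (fun _ => rfl) fun e => ?_, hB _, (hB _).trans (by simp),
    fun e he => (hB _).trans (by simp [he])⟩
  · exact range_some_eq_compl (α := G.V)
  · exact if_pos rfl
  · exact (hA _).trans (if_pos rfl)
  · exact fun e e' h => Subtype.ext (Option.some_injective _ h)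
  · change Set.range (fun e : {e // e ≠ e₀} => some e.1) = ({some e₀, none} : Set (Option G.E))ᶜ
    ext (_ | e) <;> simp
  · exact fun e => (hA _).trans (if_neg e.2)
  · by_cases h : e = e₀
    · refine (onE_comp_of_eq_pair ((hA e).trans (if_pos h))).trans ?_
      rw [hB, hB]
      simp [h, he₀]
    · refine (onE_comp_of_eq_singleton ((hA e).trans (if_neg h))).trans ?_
      rw [hB]
      simp [h]

/-! ### Gluing two vertices -/

open Classical in
/-- The map sending `y` to `x` and fixing everything else. -/
noncomputable def glue {V : Type u} {x y : V} (h : x ≠ y) (v : V) : {v // v ≠ y} :=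
  if hv : v = y then ⟨x, h⟩ else ⟨v, hv⟩

theorem glue_surjective {V : Type u} {x y : V} (h : x ≠ y) : Function.Surjective (glue h) :=
  fun v => ⟨v.1, by simp [glue, v.2]⟩

theorem glue_eq_glue {V : Type u} {x y : V} (h : x ≠ y) (p q : V) :
    glue h p = glue h q ↔ p = q ∨ (p = x ∧ q = y) ∨ (p = y ∧ q = x) := by
  unfold glue
  by_cases hp : p = y <;> by_cases hq : q = y <;> simp [hp, hq, Subtype.ext_iff]; grind

/-- Functions agreeing on `x` and `y` descend to the quotient; this is applied to heights, to
sources and targets, and to `F` itself. -/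
theorem apply_glue {V W : Type*} {x y : V} (h : x ≠ y) (f : V → W) (hf : f x = f y) (v : V) :
    f (glue h v).1 = f v := by
  unfold glue
  split_ifs with hv
  · rw [hf, hv]
  · rfl

/-- Identification of two vertices; the height function `f` guarantees acyclicity. -/
noncomputable def merging (G : CausalNet.{u}) {x y : G.V} (h : x ≠ y) {α : Type*} [Preorder α]
    (f : G.V → α) (hxy : f x = f y) (hf : ∀ e, f (G.src e) < f (G.tgt e)) : CausalNet.{u} where
  V := {v : G.V // v ≠ y}
  E := G.E
  src e := glue h (G.src e)
  tgt e := glue h (G.tgt e)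
  finite_V := inferInstance
  finite_E := inferInstance
  acyclic := acyclic_of_lt (fun v : {v // v ≠ y} => f v.1) fun e => by
    simpa only [apply_glue h f hxy] using hf e

theorem exists_merging (F : G ⟶ H) {x y : G.V} (h : x ≠ y) (hF : onV F x = onV F y)
    {α : Type*} [Preorder α] (f : G.V → α) (hxy : f x = f y)
    (hf : ∀ e, f (G.src e) < f (G.tgt e)) :
    ∃ (A : G ⟶ G.merging h f hxy hf) (B : G.merging h f hxy hf ⟶ H), fundamental A ∧
      A ≫ B = F ∧ ∀ e : G.E, onE (G := G.merging h f hxy hf) B e = onE F e := by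
  let A : G ⟶ G.merging h f hxy hf :=
    homMk (H := G.merging h f hxy hf) (glue h) (fun e => ([e] : List G.E)) fun e => ⟨rfl, rfl⟩
  let B : G.merging h f hxy hf ⟶ H :=
    homMk (G := G.merging h f hxy hf) (fun v : {v // v ≠ y} => onV F v.1) (fun e : G.E => onE F e) (fun e => by
      have := isWalk_onE F e
      rw [← apply_glue h (onV F) hF, ← apply_glue h (onV F) hF (G.tgt e)] at this
      exact this)
  have hA : ∀ e : G.E, onE A e = ([e] : List G.E) := onE_homMk _ _ _
  have hB : ∀ e : G.E, onE (G := G.merging h f hxy hf) B e = onE F e := onE_homMk (G := G.merging h f hxy hf) _ _ _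
  refine ⟨A, B, .inr (.inr (.inr (.inl ⟨x, y, fun e => e, h, ⟨glue_surjective h, glue_eq_glue h⟩,
    Function.bijective_id, hA⟩))), hom_ext (apply_glue h _ hF) fun e => ?_, hB⟩
  exact (onE_comp_of_eq_singleton (hA e)).trans (hB e)

/-! ### Contracting an edge -/

/-- Contraction of an edge; the height function `f` guarantees acyclicity. -/
noncomputable def contraction (G : CausalNet.{u}) {e₀ : G.E} (h : G.src e₀ ≠ G.tgt e₀)
    {α : Type*} [Preorder α] (f : G.V → α) (he₀ : f (G.src e₀) = f (G.tgt e₀))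
    (hf : ∀ e ≠ e₀, f (G.src e) < f (G.tgt e)) : CausalNet.{u} where
  V := {v : G.V // v ≠ G.tgt e₀}
  E := {e : G.E // e ≠ e₀}
  src e := glue h (G.src e.1)
  tgt e := glue h (G.tgt e.1)
  finite_V := inferInstance
  finite_E := inferInstance
  acyclic := acyclic_of_lt (fun v : {v // v ≠ G.tgt e₀} => f v.1) fun e => by
    simpa only [apply_glue h f he₀] using hf e.1 e.2

theorem exists_contraction (F : G ⟶ H) {e₀ : G.E} (h : G.src e₀ ≠ G.tgt e₀) (hF : onE F e₀ = [])
    {α : Type*} [Preorder α] (f : G.V → α) (he₀ : f (G.src e₀) = f (G.tgt e₀))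
    (hf : ∀ e ≠ e₀, f (G.src e) < f (G.tgt e)) :
    ∃ (A : G ⟶ G.contraction h f he₀ hf) (B : G.contraction h f he₀ hf ⟶ H), fundamental A ∧
      A ≫ B = F ∧
      ∀ e : {e : G.E // e ≠ e₀}, onE (G := G.contraction h f he₀ hf) B e = onE F e.1 := by
  classical
  have hFV : onV F (G.src e₀) = onV F (G.tgt e₀) := by
    have := isWalk_onE F e₀
    rwa [hF] at this
  let A : G ⟶ G.contraction h f he₀ hf :=
    homMk (H := G.contraction h f he₀ hf) (glue h)
      (fun e => if he : e = e₀ then [] else ([⟨e, he⟩] : List {e : G.E // e ≠ e₀})) (by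
        intro e
        by_cases he : e = e₀
        · subst he
          have key : ∀ l, l = [] → (G.contraction h f he₀ hf).IsWalk (glue h (G.src e)) l
              (glue h (G.tgt e)) := by
            rintro _ rfl
            exact (glue_eq_glue h _ _).2 (.inr (.inl ⟨rfl, rfl⟩))
          exact key _ (dif_pos rfl)
        · simp [IsWalk, he, contraction])
  let B : G.contraction h f he₀ hf ⟶ H :=
    homMk (G := G.contraction h f he₀ hf) (fun v : {v // v ≠ G.tgt e₀} => onV F v.1)
      (fun e : {e : G.E // e ≠ e₀} => onE F e.1) (by
      rintro ⟨e, he⟩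
      have := isWalk_onE F e
      rw [← apply_glue h (onV F) hFV, ← apply_glue h (onV F) hFV (G.tgt e)] at this
      exact this)
  have hA : ∀ e : G.E, onE A e =
      if he : e = e₀ then [] else ([⟨e, he⟩] : List {e : G.E // e ≠ e₀}) := onE_homMk _ _ _
  have hB : ∀ e : {e : G.E // e ≠ e₀}, onE (G := G.contraction h f he₀ hf) B e = onE F e.1 :=
    onE_homMk (G := G.contraction h f he₀ hf) _ _ _
  refine ⟨A, B, .inr (.inr (.inr (.inr (.inr ⟨e₀, fun e => e,
    ⟨glue_surjective h, glue_eq_glue h⟩, (hA _).trans (dif_pos rfl),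
    Function.bijective_id, fun e => (hA _).trans (dif_neg e.2)⟩)))), hom_ext (apply_glue h _ hFV)
    fun e => ?_, hB⟩
  by_cases he : e = e₀
  · exact (onE_comp_of_eq_nil ((hA e).trans (dif_pos he))).trans (by rw [he, hF])
  · exact (onE_comp_of_eq_singleton ((hA e).trans (dif_neg he))).trans (hB _)

/-! ### Coarse-graining two parallel edges -/

/-- Deletion of an edge. -/
def edgeDeletion (G : CausalNet.{u}) (e₀ : G.E) : CausalNet.{u} where
  V := G.V
  E := {e : G.E // e ≠ e₀}
  src e := G.src e.1
  tgt e := G.tgt e.1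
  finite_V := inferInstance
  finite_E := inferInstance
  acyclic := by
    obtain ⟨f, -, hf⟩ := G.acyclic.exists_injective_lt
    exact acyclic_of_lt (α := ℕ) f fun e => hf e.1

theorem exists_coarseGraining (F : G ⟶ H) {e₁ e₂ : G.E} (h : e₁ ≠ e₂) (hs : G.src e₁ = G.src e₂)
    (ht : G.tgt e₁ = G.tgt e₂) (hF : onE F e₁ = onE F e₂) :
    ∃ (A : G ⟶ G.edgeDeletion e₂) (B : G.edgeDeletion e₂ ⟶ H), fundamental A ∧ A ≫ B = F ∧
      ∀ e : {e : G.E // e ≠ e₂}, onE (G := G.edgeDeletion e₂) B e = onE F e.1 := by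
  let A : G ⟶ G.edgeDeletion e₂ :=
    homMk (H := G.edgeDeletion e₂) (fun v => v)
      -- Here `glue` acts on edges, replacing `e₂` by `e₁`.
      (fun e => ([glue h e] : List {e : G.E // e ≠ e₂}))
      fun e => ⟨apply_glue h G.src hs e, apply_glue h G.tgt ht e⟩
  let B : G.edgeDeletion e₂ ⟶ H :=
    homMk (G := G.edgeDeletion e₂) (fun v : G.V => onV F v)
      (fun e : {e : G.E // e ≠ e₂} => onE F e.1) fun e => isWalk_onE F e.1
  have hA : ∀ e : G.E, onE A e = ([glue h e] : List {e : G.E // e ≠ e₂}) := onE_homMk _ _ _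
  have hB : ∀ e : {e : G.E // e ≠ e₂}, onE (G := G.edgeDeletion e₂) B e = onE F e.1 :=
    onE_homMk (G := G.edgeDeletion e₂) _ _ _
  refine ⟨A, B, .inr (.inr (.inr (.inr (.inl ⟨e₁, e₂, glue h, h, hs, ht, Function.bijective_id,
    glue_surjective h, glue_eq_glue h, hA⟩)))), hom_ext (fun _ => rfl) fun e => ?_, hB⟩
  exact (onE_comp_of_eq_singleton (hA e)).trans ((hB _).trans (apply_glue h (onE F) hF e))

/-! ### Adding a vertex or an edge -/

/-- Addition of an isolated vertex `none`. -/
def vertexAddition (G : CausalNet.{u}) : CausalNet.{u} where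
  V := Option G.V
  E := G.E
  src e := some (G.src e)
  tgt e := some (G.tgt e)
  finite_V := inferInstance
  finite_E := inferInstance
  acyclic := by
    obtain ⟨f, -, hf⟩ := G.acyclic.exists_injective_lt
    exact acyclic_of_lt (α := ℕ) (fun v : Option G.V => v.elim 0 f) hf

theorem exists_vertexAddition (F : G ⟶ H) (w : H.V) :
    ∃ (A : G ⟶ G.vertexAddition) (B : G.vertexAddition ⟶ H), fundamental A ∧ A ≫ B = F ∧
      (∀ v : Option G.V, onV (G := G.vertexAddition) B v = v.elim w (onV F)) ∧
      ∀ e : G.E, onE (G := G.vertexAddition) B e = onE F e := by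
  let A : G ⟶ G.vertexAddition :=
    homMk (H := G.vertexAddition) (fun v => (some v : Option G.V)) (fun e => ([e] : List G.E))
      fun e => ⟨rfl, rfl⟩
  let B : G.vertexAddition ⟶ H :=
    homMk (G := G.vertexAddition) (fun v : Option G.V => v.elim w (onV F)) (fun e : G.E => onE F e)
      fun e => isWalk_onE F e
  have hA : ∀ e : G.E, onE A e = ([e] : List G.E) := onE_homMk _ _ _
  have hB : ∀ e : G.E, onE (G := G.vertexAddition) B e = onE F e := onE_homMk (G := G.vertexAddition) _ _ _
  refine ⟨A, B, .inr (.inr (.inl ⟨(none : Option G.V), fun e => e, fun e =>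
    ⟨Option.some_ne_none _, Option.some_ne_none _⟩, Option.some_injective _, ?_,
    Function.bijective_id, hA⟩)), hom_ext (fun _ => rfl) fun e => ?_, fun _ => rfl, hB⟩
  · exact range_some_eq_compl (α := G.V)
  · exact (onE_comp_of_eq_singleton (hA e)).trans (hB _)

/-- Addition of an edge `none` from `x` to `y`; the height function `f` guarantees acyclicity. -/
def edgeAddition (G : CausalNet.{u}) (x y : G.V) {α : Type*} [Preorder α]
    (f : G.V → α) (hxy : f x < f y) (hf : ∀ e, f (G.src e) < f (G.tgt e)) : CausalNet.{u} where
  V := G.V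
  E := Option G.E
  src e := e.elim x G.src
  tgt e := e.elim y G.tgt
  finite_V := inferInstance
  finite_E := inferInstance
  acyclic := acyclic_of_lt f (by rintro (_ | e); exacts [hxy, hf e])

theorem exists_edgeAddition (F : G ⟶ H) {x y : G.V} {α : Type*} [Preorder α]
    (f : G.V → α) (hxy : f x < f y) (hf : ∀ e, f (G.src e) < f (G.tgt e)) {l : List H.E}
    (hl : H.IsWalk (onV F x) l (onV F y)) :
    ∃ (A : G ⟶ G.edgeAddition x y f hxy hf) (B : G.edgeAddition x y f hxy hf ⟶ H),
      fundamental A ∧ A ≫ B = F ∧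
      (∀ v : G.V, onV (G := G.edgeAddition x y f hxy hf) B v = onV F v) ∧
      ∀ e : Option G.E, onE (G := G.edgeAddition x y f hxy hf) B e = e.elim l (onE F) := by
  let A : G ⟶ G.edgeAddition x y f hxy hf :=
    homMk (H := G.edgeAddition x y f hxy hf) (fun v => v)
      (fun e => ([some e] : List (Option G.E))) fun e => ⟨rfl, rfl⟩
  let B : G.edgeAddition x y f hxy hf ⟶ H :=
    homMk (G := G.edgeAddition x y f hxy hf) (fun v : G.V => onV F v) (fun e : Option G.E => e.elim l (onE F))
      (by rintro (_ | e); exacts [hl, isWalk_onE F e])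
  have hA : ∀ e : G.E, onE A e = ([some e] : List (Option G.E)) := onE_homMk _ _ _
  have hB : ∀ e : Option G.E, onE (G := G.edgeAddition x y f hxy hf) B e = e.elim l (onE F) :=
    onE_homMk (G := G.edgeAddition x y f hxy hf) _ _ _
  refine ⟨A, B, .inr (.inl ⟨(none : Option G.E), fun e => (some e : Option G.E),
    Function.bijective_id, Option.some_injective _, ?_, hA⟩), hom_ext (fun _ => rfl) fun e => ?_,
    fun _ => rfl, hB⟩
  · exact range_some_eq_compl (α := G.E)
  · exact (onE_comp_of_eq_singleton (hA e)).trans (hB _)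

/-! ### Induction scheme for factorisations. -/

theorem multiplicativeClosure_comp {K : CausalNet.{u}} {A : G ⟶ K} {B : K ⟶ H}
    (hA : fundamental A) (hB : fundamental.multiplicativeClosure B) :
    fundamental.multiplicativeClosure (A ≫ B) :=
  fundamental.multiplicativeClosure.comp_mem _ _ (.of _ hA) hB

/-- To prove that the morphisms satisfying `P` are composites of fundamental ones, it suffices to
split off fundamental morphisms, decreasing `m`, until `Q` holds. -/
theorem multiplicativeClosure_of_step {P Q : ∀ {G : CausalNet.{u}}, (G ⟶ H) → Prop}
    (m : ∀ {G : CausalNet.{u}}, (G ⟶ H) → ℕ)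
    (hQ : ∀ {G : CausalNet.{u}} (F : G ⟶ H), Q F → fundamental.multiplicativeClosure F)
    (step : ∀ {G : CausalNet.{u}} (F : G ⟶ H), P F → Q F ∨ ∃ (K : CausalNet.{u}) (A : G ⟶ K)
      (B : K ⟶ H), fundamental A ∧ A ≫ B = F ∧ P B ∧ m B < m F) :
    ∀ {G : CausalNet.{u}} (F : G ⟶ H), P F → fundamental.multiplicativeClosure F := by
  intro G F
  induction h : m F using Nat.strong_induction_on generalizing G with
  | _ n ih =>
    intro hF
    rcases step F hF with hF | ⟨K, A, B, hA, rfl, hB, hm⟩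
    · exact hQ F hF
    · exact multiplicativeClosure_comp hA (ih _ (h ▸ hm) B rfl hB)

/-! ### Isomorphisms -/

/-- Every fundamental type changes the number of vertices or edges, so an isomorphism is not itself
fundamental. It is obtained by adding an isolated vertex and merging it with an existing vertex `x`,
which is why `H` must be nonempty. -/
theorem multiplicativeClosure_of_bijective [Nonempty H.V] (F : G ⟶ H) (φ : G.E → H.E)
    (hφ : ∀ e, onE F e = [φ e]) (hV : Function.Bijective (onV F)) (hE : Function.Bijective φ) :
    fundamental.multiplicativeClosure F := by
  obtain ⟨w⟩ := ‹Nonempty H.V›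
  obtain ⟨x, rfl⟩ := hV.2 w
  have key : ∀ p q : Option G.V, p.elim (onV F x) (onV F) = q.elim (onV F x) (onV F) ↔
      p = q ∨ (p = none ∧ q = some x) ∨ (p = some x ∧ q = none) := by
    rintro (_ | p) (_ | q) <;> simp [hV.1.eq_iff, eq_comm]
  obtain ⟨A, B, hA, rfl, hBV, hBE⟩ := exists_vertexAddition F (onV F x)
  refine multiplicativeClosure_comp hA (.of _ (.inr (.inr (.inr (.inl ⟨(none : Option G.V),
    (some x : Option G.V), φ, Option.some_ne_none _ |>.symm, ⟨?_, ?_⟩, hE,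
    fun e => (hBE e).trans (hφ e)⟩)))))
  · intro w
    obtain ⟨v, rfl⟩ := hV.2 w
    exact ⟨(some v : Option G.V), hBV (some v)⟩
  · exact fun p q => (iff_of_eq (congrArg₂ Eq (hBV p) (hBV q))).trans (key p q)

/-! ### Embeddings -/

theorem multiplicativeClosure_of_injective [Nonempty H.V] (F : G ⟶ H)
    (h : ∃ φ : G.E → H.E, (∀ e, onE F e = [φ e]) ∧ Function.Injective (onV F) ∧
      Function.Injective φ) :
    fundamental.multiplicativeClosure F := by
  refine multiplicativeClosure_of_step
    (P := fun {G} F => ∃ φ : G.E → H.E, (∀ e, onE F e = [φ e]) ∧ Function.Injective (onV F) ∧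
      Function.Injective φ)
    (Q := fun {G} F => ∃ φ : G.E → H.E, (∀ e, onE F e = [φ e]) ∧ Function.Bijective (onV F) ∧
      Function.Bijective φ)
    (fun {G} F => (Nat.card H.V - Nat.card G.V) + (Nat.card H.E - Nat.card G.E))
    (fun F ⟨φ, hφ, hV, hE⟩ => multiplicativeClosure_of_bijective F φ hφ hV hE) ?_ F h
  rintro G F ⟨φ, hφ, hV, hE⟩
  by_cases hsV : Function.Surjective (onV F)
  swap
  · right
    obtain ⟨w, hw⟩ := not_forall.1 hsV
    obtain ⟨A, B, hA, hAB, hBV, hBE⟩ := exists_vertexAddition F w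
    have hinj : Function.Injective fun v : Option G.V => v.elim w (onV F) := by
      rintro (_ | p) (_ | q) hpq
      · rfl
      · exact absurd ⟨q, hpq.symm⟩ hw
      · exact absurd ⟨p, hpq⟩ hw
      · exact congrArg some (hV hpq)
    refine ⟨_, A, B, hA, hAB, ⟨φ, fun e => (hBE e).trans (hφ e), fun p q hpq => hinj ?_, hE⟩, ?_⟩
    · exact (hBV p).symm.trans (hpq.trans (hBV q))
    -- Injectivity of the extended map bounds the enlarged vertex set by `H.V`, so the truncated
    -- difference really drops.
    · have := Nat.card_le_card_of_injective _ hinj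
      rw [Finite.card_option] at this
      change Nat.card H.V - Nat.card (Option G.V) + (Nat.card H.E - Nat.card G.E) < _
      rw [Finite.card_option]
      omega
  -- Vertices are completed before edges, so that both ends of a missing edge already lie in the
  -- image.
  by_cases hsE : Function.Surjective φ
  · exact .inl ⟨φ, hφ, ⟨hV, hsV⟩, hE, hsE⟩
  right
  obtain ⟨f, hf⟩ := not_forall.1 hsE
  obtain ⟨x, hx⟩ := hsV (H.src f)
  obtain ⟨y, hy⟩ := hsV (H.tgt f)
  obtain ⟨g, -, hg⟩ := H.acyclic.exists_injective_lt
  obtain ⟨A, B, hA, hAB, hBV, hBE⟩ := exists_edgeAddition F (x := x) (y := y)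
    (fun v => g (onV F v)) (by simpa only [hx, hy] using hg f)
    (fun e => onV_lt_of_ne_nil g hg F e (by simp [hφ])) (l := [f]) ⟨hx.symm, hy.symm⟩
  have hinj : Function.Injective fun e : Option G.E => e.elim f φ := by
    rintro (_ | p) (_ | q) hpq
    · rfl
    · exact absurd ⟨q, hpq.symm⟩ hf
    · exact absurd ⟨p, hpq⟩ hf
    · exact congrArg some (hE hpq)
  refine ⟨_, A, B, hA, hAB, ⟨fun e : Option G.E => e.elim f φ, ?_, fun p q hpq => hV ?_, hinj⟩, ?_⟩
  · rintro (_ | e)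
    · exact hBE none
    · exact (hBE (some e)).trans (hφ e)
  · exact (hBV p).symm.trans (hpq.trans (hBV q))
  · have := Nat.card_le_card_of_injective _ hinj
    rw [Finite.card_option] at this
    change Nat.card H.V - Nat.card G.V + (Nat.card H.E - Nat.card (Option G.E)) < _
    rw [Finite.card_option]
    omega

theorem card_ne_add_one {α : Type*} [Finite α] (a : α) :
    Nat.card {b // b ≠ a} + 1 = Nat.card α := by
  classical
  rw [← Finite.card_option]
  exact Nat.card_congr (Equiv.optionSubtypeNe a)

/-! ### Morphisms sending every edge to an edge -/

theorem multiplicativeClosure_of_edge_to_edge [Nonempty H.V] (F : G ⟶ H)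
    (h : ∃ φ : G.E → H.E, ∀ e, onE F e = [φ e]) :
    fundamental.multiplicativeClosure F := by
  refine multiplicativeClosure_of_step
    (P := fun {G} F => ∃ φ : G.E → H.E, ∀ e, onE F e = [φ e])
    (Q := fun {G} F => ∃ φ : G.E → H.E, (∀ e, onE F e = [φ e]) ∧ Function.Injective (onV F) ∧
      Function.Injective φ)
    (fun {G} F => Nat.card G.V + Nat.card G.E) multiplicativeClosure_of_injective ?_ F h
  rintro G F ⟨φ, hφ⟩
  by_cases hV : Function.Injective (onV F)
  swap
  · right
    simp only [Function.Injective, not_forall] at hV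
    obtain ⟨x, y, hF, hxy⟩ := hV
    obtain ⟨g, -, hg⟩ := H.acyclic.exists_injective_lt
    obtain ⟨A, B, hA, hAB, hB⟩ := exists_merging F hxy hF (fun v => g (onV F v)) (congrArg g hF)
      fun e => onV_lt_of_ne_nil g hg F e (by simp [hφ])
    refine ⟨_, A, B, hA, hAB, ⟨φ, fun e => (hB e).trans (hφ e)⟩, ?_⟩
    change Nat.card {v // v ≠ y} + Nat.card G.E < _
    have := card_ne_add_one y
    omega
  by_cases hE : Function.Injective φ
  · exact .inl ⟨φ, hφ, hV, hE⟩
  right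
  simp only [Function.Injective, not_forall] at hE
  obtain ⟨e₁, e₂, hF, he⟩ := hE
  -- With `onV F` injective, two edges with the same image are parallel.
  have h₁ := isWalk_onE F e₁
  have h₂ := isWalk_onE F e₂
  rw [hφ, isWalk_singleton] at h₁ h₂
  rw [hF] at h₁
  obtain ⟨A, B, hA, hAB, hB⟩ := exists_coarseGraining F he (hV (h₁.1.symm.trans h₂.1))
    (hV (h₁.2.symm.trans h₂.2)) (by rw [hφ, hφ, hF])
  refine ⟨_, A, B, hA, hAB, ⟨fun e : {e // e ≠ e₂} => φ e.1, fun e => (hB e).trans (hφ _)⟩, ?_⟩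
  change Nat.card G.V + Nat.card {e // e ≠ e₂} < _
  have := card_ne_add_one e₂
  omega

/-! ### Morphisms sending every edge to an edge or an identity -/

/-- Let `e₀` be an edge sent to an identity whose height is minimal among such edges. If no other
such edge is parallel to `e₀`, then contracting `e₀` creates no directed cycle. -/
theorem exists_height_of_minimal (F : G ⟶ H) (f : G.V → ℕ) (hf : Function.Injective f)
    (hfE : ∀ e, f (G.src e) < f (G.tgt e)) (e₀ : G.E) (he₀ : onE F e₀ = [])
    (hmin : ∀ e, onE F e = [] → f (G.tgt e₀) - f (G.src e₀) ≤ f (G.tgt e) - f (G.src e))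
    (hpar : ∀ e, onE F e = [] → G.src e = G.src e₀ → G.tgt e = G.tgt e₀ → e = e₀) :
    ∃ k : G.V → ℕ ×ₗ ℕ, k (G.src e₀) = k (G.tgt e₀) ∧
      ∀ e ≠ e₀, k (G.src e) < k (G.tgt e) := by
  classical
  obtain ⟨g, -, hg⟩ := H.acyclic.exists_injective_lt
  have h₀ := isWalk_onE F e₀
  rw [he₀] at h₀
  change onV F (G.src e₀) = onV F (G.tgt e₀) at h₀
  have hlt := hfE e₀
  -- Edges not sent to identities raise the first coordinate. The second is `f` with the interval
  -- spanned by `e₀` collapsed: an edge sent to an identity fails to raise it only if both its ends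
  -- lie in that interval. By minimality they then have the heights of the ends of `e₀`, so the edge
  -- is parallel to `e₀` and equals it by `hpar`.
  refine ⟨fun v => toLex (g (onV F v),
    if f (G.src e₀) ≤ f v ∧ f v ≤ f (G.tgt e₀) then f (G.src e₀) else f v), ?_, fun e he => ?_⟩
  · simp [h₀, hlt.le]
  · rw [Prod.Lex.toLex_lt_toLex]
    by_cases hn : onE F e = []
    · right
      have h₁ := isWalk_onE F e
      rw [hn] at h₁
      refine ⟨congrArg g h₁, ?_⟩
      have h₂ := hmin e hn
      have h₃ := hfE e
      have h₄ : ¬ (f (G.src e) = f (G.src e₀) ∧ f (G.tgt e) = f (G.tgt e₀)) :=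
        fun h => he (hpar e hn (hf h.1) (hf h.2))
      dsimp only
      split_ifs <;> omega
    · exact .inl (onV_lt_of_ne_nil g hg F e hn)

theorem multiplicativeClosure_of_length_le_one [Nonempty H.V] (F : G ⟶ H)
    (h : ∀ e, (onE F e).length ≤ 1) :
    fundamental.multiplicativeClosure F := by
  refine multiplicativeClosure_of_step
    (P := fun {G} F => ∀ e : G.E, (onE F e).length ≤ 1)
    (Q := fun {G} F => ∃ φ : G.E → H.E, ∀ e, onE F e = [φ e])
    (fun {G} F => Nat.card G.E) multiplicativeClosure_of_edge_to_edge ?_ F h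
  intro G F hF
  by_cases hnil : ∃ e, onE F e = []
  swap
  · left
    have hone : ∀ e, ∃ f, onE F e = [f] := fun e => List.length_eq_one_iff.1 ((hF e).antisymm
      (List.length_pos_iff.2 fun he => hnil ⟨e, he⟩))
    choose φ hφ using hone
    exact ⟨φ, hφ⟩
  right
  obtain ⟨f, hf, hfE⟩ := G.acyclic.exists_injective_lt
  obtain ⟨e₀, he₀, hmin⟩ := Set.exists_min_image {e | onE F e = []}
    (fun e => f (G.tgt e) - f (G.src e)) (Set.toFinite _) hnil
  have hcard := card_ne_add_one e₀
  by_cases hpar : ∀ e, onE F e = [] → G.src e = G.src e₀ → G.tgt e = G.tgt e₀ → e = e₀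
  · obtain ⟨k, hk₀, hk⟩ := exists_height_of_minimal F f hf hfE e₀ he₀ hmin hpar
    obtain ⟨A, B, hA, hAB, hB⟩ := exists_contraction F (fun h => (hfE e₀).ne (congrArg f h)) he₀
      k hk₀ hk
    refine ⟨_, A, B, hA, hAB, fun e => (congrArg List.length (hB e)).trans_le (hF _), ?_⟩
    change Nat.card {e // e ≠ e₀} < _
    omega
  -- Contracting `e₀` would turn a parallel edge into a loop, so the two are identified instead.
  · push Not at hpar
    obtain ⟨e, he, hs, ht, hne⟩ := hpar
    obtain ⟨A, B, hA, hAB, hB⟩ := exists_coarseGraining F hne hs ht (he.trans he₀.symm)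
    refine ⟨_, A, B, hA, hAB, fun e => (congrArg List.length (hB e)).trans_le (hF _), ?_⟩
    change Nat.card {e // e ≠ e₀} < _
    omega

/-! ### Arbitrary morphisms -/

theorem multiplicativeClosure_of_nonempty [Nonempty H.V] (F : G ⟶ H) :
    fundamental.multiplicativeClosure F := by
  refine multiplicativeClosure_of_step (P := fun _ => True)
    (Q := fun {G} F => ∀ e : G.E, (onE F e).length ≤ 1)
    -- This counts the subdivisions still needed; by truncation, edges sent to identities contribute
    -- `0`.
    (fun {G} F => ∑ᶠ e : G.E, ((onE F e).length - 1))
    multiplicativeClosure_of_length_le_one ?_ F trivial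
  rintro G F -
  refine or_iff_not_imp_left.2 fun hF => ?_
  push Not at hF
  obtain ⟨e₀, he₀⟩ := hF
  obtain ⟨a, b, l, h⟩ : ∃ a b l, onE F e₀ = a :: b :: l := by
    rcases h : onE F e₀ with _ | ⟨a, _ | ⟨b, l⟩⟩
    · simp [h] at he₀
    · simp [h] at he₀
    · exact ⟨a, b, l, rfl⟩
  obtain ⟨A, B, hA, hAB, hn, hs, hB⟩ := exists_subdivision F e₀ a b l h
  refine ⟨_, A, B, hA, hAB, trivial, ?_⟩
  classical
  have := Fintype.ofFinite G.E
  have hsum : ∑ᶠ e : (G.subdivision e₀).E, ((onE B e).length - 1) =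
      ∑ e : Option G.E, ((onE (G := G.subdivision e₀) B e).length - 1) :=
    finsum_eq_sum_of_fintype fun e : Option G.E => (onE (G := G.subdivision e₀) B e).length - 1
  rw [hsum, finsum_eq_sum_of_fintype, Fintype.sum_option, hn, Fintype.sum_eq_add_sum_compl e₀, hs,
    Fintype.sum_eq_add_sum_compl e₀ (fun e => (onE F e).length - 1), h]
  have : ∀ e ∈ ({e₀}ᶜ : Finset G.E), (onE (G := G.subdivision e₀) B (some e : Option G.E)).length - 1
      = (onE F e).length - 1 := fun e he => by rw [hB e (by simpa using he)]
  rw [Finset.sum_congr rfl this]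
  simp

theorem isIso_of_isEmpty [hH : IsEmpty H.V] (F : G ⟶ H) : IsEmpty G.V ∧ IsIso F := by
  have hG : IsEmpty G.V := ⟨fun x => hH.false (onV F x)⟩
  refine ⟨hG, homMk (fun x => hH.elim x) (fun e => hH.elim (H.src e)) fun e =>
    hH.elim (H.src e), ?_, ?_⟩
  · exact hom_ext (fun x => hG.elim x) fun e => hG.elim (G.src e)
  · exact hom_ext (fun x => hH.elim x) fun e => hH.elim (H.src e)

end CausalNet

/-- Every morphism of causal-nets is a composite of finitely many morphisms of the six fundamental
types (`multiplicativeClosure` is closure under identities and composition). The empty causal-net,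
which is unique in set theory but not in type theory, is treated separately: a morphism into an
empty causal-net starts from an empty one, and is the unique identification of the two. -/
theorem mainTheorem1 {G H : CausalNet.{u}} (F : G ⟶ H) :
    (Nonempty H.V → CausalNet.fundamental.{u}.multiplicativeClosure F) ∧
    (IsEmpty H.V → IsEmpty G.V ∧ IsIso F) := by
  exact ⟨fun _ => CausalNet.multiplicativeClosure_of_nonempty F,
    fun _ => CausalNet.isIso_of_isEmpty F⟩
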